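/- **Setting.** Let $(\gamma)$ be a continuous, piecewise $C^2$ curve in the first quadrant of the $st$-plane, parametrized by arc length $\mu\in[0,\ell]$ as $s=L_1(\mu)$, $t=L_2(\mu)$, running from $(a,0)$ to $(0,b)$ ($a,b>0$), with $L_1$ non-increasing and $L_2$ non-decreasing, and meeting the coordinate axes only at its end points. Let $G=\bigcup_{P\in(\gamma)}W(P)$ be the closed region bounded by $[0,a]$ on the $s$-axis, $[0,b]$ on the $t$-axis and $(\gamma)$, where $W(s,t)=\{(\sigma,\tau):0\le\sigma\le s,\ 0\le\tau\le t\}$. Let $P_0=(a,0),P_1,\dots,P_N,P_{N+1}=(0,b)$ be finitely many points of $(\gamma)$, in order of increasing $\mu$ (the vertices), that include all points where the normal of $(\gamma)$ jumps. The normal is continuous on each open arc between consecutive vertices and has limits at its ends. Let $(n_1,n_2)=(L_2',-L_1')$ be the outward unit normal and $x_\mu=-n_2x_s+n_1x_t$. Let $u:G\to\mathbb R^m$ be a piecewise continuous control (there are finitely many open sets on each of which $u$ is continuous and whose closures have union $G$) with $\underline u^j\le u^j\le\overline u^j$. Let $x:G\to\mathbb R^n$ be a $C^1$ state solving, in integral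 form, $$x_{st}=f(s,t,x,x_s,x_t,u),\quad x(s,0)=x_1(s),\quad x(0,t)=x_2(t),$$ i.e. $x(s,t)=x_1(s)+x_2(t)-x_1(0)+\iint_{W(s,t)}f\,dA$ on $G$ with $f$ integrable along the trajectory, $x_1,x_2$ continuous and $x_1(0)=x_2(0)$. Let $\Phi(s,t,x,p,q,u)$, $\Phi_1(s,t,x,\eta)$ (on $(\gamma)$) and $\Phi_0(P,x)$ (at vertices) be given real functions. All functions below are evaluated along $(x,p,q,\eta,u)=(x,x_s,x_t,x_\mu,u)$, and repeated indices $i,l$ are summed. Put $$F_i=\Phi_{x^i}-\tfrac{D}{Ds}\Phi_{p^i}-\tfrac{D}{Dt}\Phi_{q^i},\qquad F_{1,i}=n_1\Phi_{p^i}+n_2\Phi_{q^i}+\Phi_{1,x^i}-\tfrac{D}{D\mu}\Phi_{1,\eta^i},$$ $$F_{0,i}(P_r)=\Phi_{0,x^i}(P_r,x(P_r))-V_r(\Phi_{1,\eta^i}),$$ where $D/Ds,D/Dt,D/D\mu$ are total derivatives along the trajectory and $V_r(\varphi)=\varphi(P_r^+)-\varphi(P_r^-)$ is the jump of $\varphi$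 at $P_r$ in the direction of increasing $\mu$. Assume that the functions involved are regular enough for these expressions to make sense: $f,\Phi$ are $C^1$ in $(x,p,q)$, $\Phi_1$ in $(x,\eta)$, $\Phi_0$ in $x$; the derivatives $f_x,f_p,f_q$ along the trajectory are continuous on $G$; the derivatives $\frac{D}{Ds}\Phi_{p^i}$, $\frac{D}{Dt}\Phi_{q^i}$ exist almost everywhere in $G$ and $F_i$ is integrable on $G$; $\Phi_{1,\eta^i}$ is continuous on the open arcs between consecutive vertices with one-sided limits at the vertices, $\frac{D}{D\mu}\Phi_{1,\eta^i}$ exists almost everywhere on $(\gamma)$, and $F_{1,i}$ is integrable on $(\gamma)$. Let $R=[R^i_j(s,t,\sigma,\tau)]$, for $(s,t)\in G$, $(\sigma,\tau)\in W(s,t)$, be the matrix-valued Riemann function of the linearized equation: $R$, $\partial_sR$ and $\partial_tR$ (derivatives in the first pair of variables) are continuous and $$\tfrac{\partial^2}{\partial s\partial t}R^i_j=f^i_{x^l}R^l_j+f^i_{p^l}\tfrac{\partial}{\partial s}R^l_j+f^i_{q^l}\tfrac{\partial}{\partial t}R^l_j\quad(s>\sigma,\ t>\tau),$$ $$\tfrac{\partial}{\partial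 s}R^i_j=f^i_{q^l}R^l_j\ \ (t=\tau),\qquad \tfrac{\partial}{\partial t}R^i_j=f^i_{p^l}R^l_j\ \ (s=\sigma),\qquad R^i_j(\sigma,\tau,\sigma,\tau)=\delta^i_j,$$ where the coefficients are evaluated at $(s,t)$. With $E(s,t)=\{P\in G:(s,t)\in W(P)\}$ and $\gamma(s,t)=\{P\in(\gamma):(s,t)\in W(P)\}$, the co-state is $$\psi_j(s,t)=\iint_{E(s,t)}F_i(\sigma,\tau)R^i_j(\sigma,\tau,s,t)\,dA+\int_{\gamma(s,t)}F_{1,i}(\sigma,\tau)R^i_j(\sigma,\tau,s,t)\,d\mu+\sum_{\substack{1\le r\le N\\(s,t)\in W(P_r)}}F_{0,i}(P_r)R^i_j(P_r,s,t).$$ For $P=(s(P),t(P))$ let $$W^{\rm III}(P)=\{(s,t)\in\operatorname{int}G:s<s(P),t<t(P)\},\qquad W^{\rm II}(P)=\{(s,t)\in\operatorname{int}G:s<s(P),t>t(P)\},$$ $$W^{\rm IV}(P)=\{(s,t)\in\operatorname{int}G:s>s(P),t<t(P)\}.$$ For $P\in(\gamma)$ let $L_s(P)$ (resp. $L_t(P)$)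 be the set of points $Q\ne P$ of $(\gamma)$ that precede (resp. follow) $P$ in the direction of increasing $\mu$ and for which the segment $PQ$ is parallel to the $s$-axis (resp. $t$-axis) and contained in $(\gamma)$. Put $L(P)=L_s(P)\cup L_t(P)\cup\{P\}$. Let $S(P)$, $T(P)$ be the sets of vertices in $L_s(P)$, $L_t(P)$, and for a vertex $P$ put $V(P)=S(P)\cup T(P)\cup\{P\}$. **Theorem 4.2.** For every vertex $P_k$, $0\le k\le N+1$, and every $1\le j\le n$, $$\lim_{\substack{(s,t)\to P_k\\(s,t)\in W^{\rm III}(P_k)}}\psi_j(s,t)=\int_{L(P_k)}F_{1,i}(\sigma,\tau)R^i_j(\sigma,\tau,P_k)\,d\mu+\sum_{P\in V(P_k)}F_{0,i}(P)R^i_j(P,P_k),$$ $$\lim_{\substack{(s,t)\to P_k\\(s,t)\in W^{\rm II}(P_k)}}\psi_j(s,t)=\int_{L_t(P_k)}F_{1,i}(\sigma,\tau)R^i_j(\sigma,\tau,P_k)\,d\mu+\sum_{P\in T(P_k)}F_{0,i}(P)R^i_j(P,P_k),$$ $$\lim_{\substack{(s,t)\to P_k\\(s,t)\in W^{\rm IV}(P_k)}}\psi_j(s,t)=\int_{L_s(P_k)}F_{1,i}(\sigma,\tau)R^i_j(\sigma,\tau,P_k)\,d\mu+\sum_{P\in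 S(P_k)}F_{0,i}(P)R^i_j(P,P_k).$$ A limit is asserted only when $P_k$ is a limit point of the set in question (for example $W^{\rm III}(P_0)=W^{\rm III}(P_{N+1})=\emptyset$). -/

import Mathlib

open Set Filter Topology MeasureTheory

namespace Goursat

/-- A boundary curve `(γ)` in the first quadrant, parametrized by arc length `μ ∈ [0, len]`,
`pt μ = (L₁ μ, L₂ μ)`, running from `(a, 0)` to `(0, b)` as a non-increasing graph, together with
the arc-length parameters `0 = μ₀ < μ₁ < ⋯ < μ_{N+1} = len` of the vertices `P₀, …, P_{N+1}`.
The curve is continuous and piecewise `C²`, and its tangent (hence its normal) can only jump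
at vertices. -/
structure Curve where
  a : ℝ
  b : ℝ
  a_pos : 0 < a
  b_pos : 0 < b
  len : ℝ
  pt : ℝ → ℝ × ℝ
  N : ℕ
  vparam : Fin (N + 2) → ℝ
  vparam_strictMono : StrictMono vparam
  vparam_zero : vparam 0 = 0
  vparam_last : vparam (Fin.last (N + 1)) = len
  pt_zero : pt 0 = (a, 0)
  pt_len : pt len = (0, b)
  continuousOn : ContinuousOn pt (Icc 0 len)
  fst_antitone : AntitoneOn (fun μ => (pt μ).1) (Icc 0 len)
  snd_monotone : MonotoneOn (fun μ => (pt μ).2) (Icc 0 len)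
  /-- The curve meets the coordinate axes only at its end points. -/
  pos : ∀ μ ∈ Ioo 0 len, 0 < (pt μ).1 ∧ 0 < (pt μ).2
  /-- The normal field is continuous along each arc between consecutive vertices, with limits
  at the two ends of the arc. -/
  contDiffOn_arc : ∀ r : Fin (N + 1),
    ContDiffOn ℝ 1 pt (Icc (vparam r.castSucc) (vparam r.succ))
  /-- Piecewise `C²`: `C²` on every closed sub-arc with no break point inside. -/
  piecewise_contDiffOn : ∃ Z : Finset ℝ, ∀ α β : ℝ, α < β → Icc α β ⊆ Icc 0 len →
    (∀ ζ ∈ Z, ζ ∉ Ioo α β) → ContDiffOn ℝ 2 pt (Icc α β)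
  /-- The parameter is arc length. -/
  unit_speed : ∀ r : Fin (N + 1), ∀ μ ∈ Ioo (vparam r.castSucc) (vparam r.succ),
    (deriv (fun ν => (pt ν).1) μ) ^ 2 + (deriv (fun ν => (pt ν).2) μ) ^ 2 = 1

/-- The rectangle `W(s,t) = {(σ,τ) : 0 ≤ σ ≤ s, 0 ≤ τ ≤ t}`. -/
def W (P : ℝ × ℝ) : Set (ℝ × ℝ) :=
  {Q | 0 ≤ Q.1 ∧ Q.1 ≤ P.1 ∧ 0 ≤ Q.2 ∧ Q.2 ≤ P.2}

namespace Curve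

/-- The curve `(γ)` as a set of points. -/
def gamma (c : Curve) : Set (ℝ × ℝ) := c.pt '' Icc 0 c.len

/-- The closed region `G` bounded by `[0,a]` on the `s`-axis, `[0,b]` on the `t`-axis and the
non-increasing curve `(γ)`: the points of the closed first quadrant that lie weakly below and
to the left of some point of `(γ)`. -/
def G (c : Curve) : Set (ℝ × ℝ) := {Q | ∃ P ∈ c.gamma, Q ∈ W P}

/-- `E(s,t) = {(σ,τ) ∈ G : (s,t) ∈ W(σ,τ)}`. -/
def E (c : Curve) (Q : ℝ × ℝ) : Set (ℝ × ℝ) := {P | P ∈ c.G ∧ Q ∈ W P}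

/-- `γ(s,t) = {(σ,τ) ∈ (γ) : (s,t) ∈ W(σ,τ)}`. -/
def gammaFrom (c : Curve) (Q : ℝ × ℝ) : Set (ℝ × ℝ) := {P | P ∈ c.gamma ∧ Q ∈ W P}

/-- The vertex `P_r`. -/
def vertex (c : Curve) (r : Fin (c.N + 2)) : ℝ × ℝ := c.pt (c.vparam r)

/-- First component of the outward unit normal at the parameter `μ`; the counterclockwise unit
tangent is `(L₁', L₂') = (-n₂, n₁)`. -/
noncomputable def n₁ (c : Curve) (μ : ℝ) : ℝ := deriv (fun ν => (c.pt ν).2) μ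

/-- Second component of the outward unit normal at the parameter `μ`. -/
noncomputable def n₂ (c : Curve) (μ : ℝ) : ℝ := -deriv (fun ν => (c.pt ν).1) μ

/-- The integral `∫_A g dμ` with respect to arc length over a part `A` of `(γ)`, for a function
`g` on `(γ)` that is given in terms of the arc-length parameter. -/
noncomputable def lineIntegral (c : Curve) (A : Set (ℝ × ℝ)) (g : ℝ → ℝ) : ℝ :=
  ∫ μ in {μ | μ ∈ Icc 0 c.len ∧ c.pt μ ∈ A}, g μ

/-- The part `W^III(P)` of the interior of `G`. -/
def WIII (c : Curve) (P : ℝ × ℝ) : Set (ℝ × ℝ) :=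
  {Q | Q ∈ interior c.G ∧ Q.1 < P.1 ∧ Q.2 < P.2}

/-- The part `W^II(P)` of the interior of `G`. -/
def WII (c : Curve) (P : ℝ × ℝ) : Set (ℝ × ℝ) :=
  {Q | Q ∈ interior c.G ∧ Q.1 < P.1 ∧ P.2 < Q.2}

/-- The part `W^IV(P)` of the interior of `G`. -/
def WIV (c : Curve) (P : ℝ × ℝ) : Set (ℝ × ℝ) :=
  {Q | Q ∈ interior c.G ∧ P.1 < Q.1 ∧ Q.2 < P.2}

/-- `L_s(P)` for the point `P` of `(γ)` with parameter `κ`: the points of `(γ)`, different from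
`P` and preceding `P`, that are joined to `P` by a segment that is parallel to the `s`-axis and
contained in `(γ)`. -/
def Ls (c : Curve) (κ : ℝ) : Set (ℝ × ℝ) :=
  {Q | ∃ μ ∈ Ico 0 κ, Q = c.pt μ ∧ Q.2 = (c.pt κ).2 ∧ segment ℝ Q (c.pt κ) ⊆ c.gamma}

/-- `L_t(P)` for the point `P` of `(γ)` with parameter `κ`: the points of `(γ)`, different from
`P` and subsequent to `P`, that are joined to `P` by a segment that is parallel to the `t`-axis
and contained in `(γ)`. -/
def Lt (c : Curve) (κ : ℝ) : Set (ℝ × ℝ) :=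
  {Q | ∃ μ ∈ Ioc κ c.len, Q = c.pt μ ∧ Q.1 = (c.pt κ).1 ∧ segment ℝ (c.pt κ) Q ⊆ c.gamma}

/-- `L(P) = L_s(P) ∪ L_t(P) ∪ {P}`. -/
def L (c : Curve) (κ : ℝ) : Set (ℝ × ℝ) := c.Ls κ ∪ c.Lt κ ∪ {c.pt κ}

open Classical in
/-- (The indices of the vertices in) `S(P_k)`. -/
noncomputable def S (c : Curve) (k : Fin (c.N + 2)) : Finset (Fin (c.N + 2)) :=
  Finset.univ.filter fun r => c.vertex r ∈ c.Ls (c.vparam k)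

open Classical in
/-- (The indices of the vertices in) `T(P_k)`. -/
noncomputable def T (c : Curve) (k : Fin (c.N + 2)) : Finset (Fin (c.N + 2)) :=
  Finset.univ.filter fun r => c.vertex r ∈ c.Lt (c.vparam k)

/-- (The indices of the vertices in) `V(P_k) = T(P_k) ∪ S(P_k) ∪ {P_k}`. -/
noncomputable def V (c : Curve) (k : Fin (c.N + 2)) : Finset (Fin (c.N + 2)) :=
  c.T k ∪ c.S k ∪ {k}

end Curve

/-- The data of the control problem: right-hand side `f(s,t,x,p,q,u)` of the state equation,
integrands `Φ(s,t,x,p,q,u)`, `Φ₁(s,t,x,η)`, `Φ₀(P,x)` of the cost functional, boundary data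
`x₁(s)`, `x₂(t)`, and componentwise bounds for the control. The slots `p`, `q`, `η` stand for
`x_s`, `x_t`, `x_μ`. -/
structure Problem (n m : ℕ) where
  f : ℝ × ℝ → (Fin n → ℝ) → (Fin n → ℝ) → (Fin n → ℝ) → (Fin m → ℝ) → Fin n → ℝ
  Φ : ℝ × ℝ → (Fin n → ℝ) → (Fin n → ℝ) → (Fin n → ℝ) → (Fin m → ℝ) → ℝ
  Φ₁ : ℝ × ℝ → (Fin n → ℝ) → (Fin n → ℝ) → ℝ
  Φ₀ : ℝ × ℝ → (Fin n → ℝ) → ℝ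
  x₁ : ℝ → Fin n → ℝ
  x₂ : ℝ → Fin n → ℝ
  uLo : Fin m → ℝ
  uHi : Fin m → ℝ

/-- A control `u`, a state `x`, and the first partial derivatives `xs`, `xt` of the state. -/
structure Trajectory (n m : ℕ) where
  u : ℝ × ℝ → Fin m → ℝ
  x : ℝ × ℝ → Fin n → ℝ
  xs : ℝ × ℝ → Fin n → ℝ
  xt : ℝ × ℝ → Fin n → ℝ

/-- The partial derivative `∂g/∂y^i` at `y`. -/
noncomputable def partialD {n : ℕ} (g : (Fin n → ℝ) → ℝ) (i : Fin n) (y : Fin n → ℝ) : ℝ :=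
  lineDeriv ℝ g y (Pi.single i 1)

/-- `u` is an admissible (piecewise continuous, bounded by the prescribed bounds) control on `G`
and `x` is a `C¹` state, on the closed region `G`, that solves the integral form of
`x_st = f(s,t,x,x_s,x_t,u)`, `x(s,0) = x₁(s)`, `x(0,t) = x₂(t)`. -/
structure IsAdmissible {n m : ℕ} (c : Curve) (D : Problem n m) (z : Trajectory n m) : Prop where
  control_bounds : ∀ P ∈ c.G, z.u P ∈ Icc D.uLo D.uHi
  control_piecewise : ∃ (K : ℕ) (O : Fin K → Set (ℝ × ℝ)),
    (∀ l, IsOpen (O l)) ∧ (⋃ l, closure (O l)) = c.G ∧ ∀ l, ContinuousOn z.u (O l)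
  continuousOn_x₁ : ContinuousOn D.x₁ (Icc 0 c.a)
  continuousOn_x₂ : ContinuousOn D.x₂ (Icc 0 c.b)
  consistent : D.x₁ 0 = D.x₂ 0
  continuousOn_x : ContinuousOn z.x c.G
  continuousOn_xs : ContinuousOn z.xs c.G
  continuousOn_xt : ContinuousOn z.xt c.G
  hasDeriv_s : ∀ P ∈ c.G,
    HasDerivWithinAt (fun s => z.x (s, P.2)) (z.xs P) {s | (s, P.2) ∈ c.G} P.1
  hasDeriv_t : ∀ P ∈ c.G,
    HasDerivWithinAt (fun t => z.x (P.1, t)) (z.xt P) {t | (P.1, t) ∈ c.G} P.2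
  integrable_f : IntegrableOn (fun Q => D.f Q (z.x Q) (z.xs Q) (z.xt Q) (z.u Q)) c.G
  state_eq : ∀ P ∈ c.G, z.x P = D.x₁ P.1 + D.x₂ P.2 - D.x₁ 0 +
    ∫ Q in W P, D.f Q (z.x Q) (z.xs Q) (z.xt Q) (z.u Q)

section Along

/-- `∂f^i/∂x^k` along the trajectory. -/
noncomputable def fx {n m : ℕ} (D : Problem n m) (z : Trajectory n m) (P : ℝ × ℝ)
    (i k : Fin n) : ℝ :=
  partialD (fun y => D.f P y (z.xs P) (z.xt P) (z.u P) i) k (z.x P)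

/-- `∂f^i/∂p^k` along the trajectory. -/
noncomputable def fp {n m : ℕ} (D : Problem n m) (z : Trajectory n m) (P : ℝ × ℝ)
    (i k : Fin n) : ℝ :=
  partialD (fun y => D.f P (z.x P) y (z.xt P) (z.u P) i) k (z.xs P)

/-- `∂f^i/∂q^k` along the trajectory. -/
noncomputable def fq {n m : ℕ} (D : Problem n m) (z : Trajectory n m) (P : ℝ × ℝ)
    (i k : Fin n) : ℝ :=
  partialD (fun y => D.f P (z.x P) (z.xs P) y (z.u P) i) k (z.xt P)

/-- `∂Φ/∂x^i` along the trajectory. -/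
noncomputable def Φx {n m : ℕ} (D : Problem n m) (z : Trajectory n m) (i : Fin n) (P : ℝ × ℝ) : ℝ :=
  partialD (fun y => D.Φ P y (z.xs P) (z.xt P) (z.u P)) i (z.x P)

/-- `∂Φ/∂p^i` along the trajectory. -/
noncomputable def Φp {n m : ℕ} (D : Problem n m) (z : Trajectory n m) (i : Fin n) (P : ℝ × ℝ) : ℝ :=
  partialD (fun y => D.Φ P (z.x P) y (z.xt P) (z.u P)) i (z.xs P)

/-- `∂Φ/∂q^i` along the trajectory. -/
noncomputable def Φq {n m : ℕ} (D : Problem n m) (z : Trajectory n m) (i : Fin n) (P : ℝ × ℝ) : ℝ :=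
  partialD (fun y => D.Φ P (z.x P) (z.xs P) y (z.u P)) i (z.xt P)

/-- The tangential derivative `x_μ = -n₂ x_s + n₁ x_t` of the state on `(γ)`. -/
noncomputable def xμ {n m : ℕ} (c : Curve) (z : Trajectory n m) (μ : ℝ) : Fin n → ℝ :=
  -c.n₂ μ • z.xs (c.pt μ) + c.n₁ μ • z.xt (c.pt μ)

/-- `∂Φ₁/∂x^i` along the trajectory, as a function on `(γ)`. -/
noncomputable def Φ₁x {n m : ℕ} (c : Curve) (D : Problem n m) (z : Trajectory n m) (i : Fin n)
    (μ : ℝ) : ℝ :=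
  partialD (fun y => D.Φ₁ (c.pt μ) y (xμ c z μ)) i (z.x (c.pt μ))

/-- `∂Φ₁/∂η^i` along the trajectory, as a function on `(γ)`. -/
noncomputable def Φ₁η {n m : ℕ} (c : Curve) (D : Problem n m) (z : Trajectory n m) (i : Fin n)
    (μ : ℝ) : ℝ :=
  partialD (fun y => D.Φ₁ (c.pt μ) (z.x (c.pt μ)) y) i (xμ c z μ)

/-- `F_i = Φ_{x^i} - (D/Ds) Φ_{p^i} - (D/Dt) Φ_{q^i}` along the trajectory. -/
noncomputable def F {n m : ℕ} (D : Problem n m) (z : Trajectory n m) (i : Fin n) (P : ℝ × ℝ) : ℝ :=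
  Φx D z i P - deriv (fun s => Φp D z i (s, P.2)) P.1 - deriv (fun t => Φq D z i (P.1, t)) P.2

/-- `F_{1,i} = n₁ Φ_{p^i} + n₂ Φ_{q^i} + Φ_{1,x^i} - (D/Dμ) Φ_{1,η^i}` on `(γ)`. -/
noncomputable def F₁ {n m : ℕ} (c : Curve) (D : Problem n m) (z : Trajectory n m) (i : Fin n)
    (μ : ℝ) : ℝ :=
  c.n₁ μ * Φp D z i (c.pt μ) + c.n₂ μ * Φq D z i (c.pt μ) + Φ₁x c D z i μ
    - deriv (Φ₁η c D z i) μ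

/-- The jump `V_r(φ) = φ(P_r⁺) - φ(P_r⁻)` at the vertex `P_r` of a function `φ` on `(γ)`, in the
direction of increasing arc length. -/
noncomputable def jump (c : Curve) (r : Fin (c.N + 2)) (φ : ℝ → ℝ) : ℝ :=
  Function.rightLim φ (c.vparam r) - Function.leftLim φ (c.vparam r)

/-- `F_{0,i}(P_r) = Φ_{0,x^i}(P_r, x(P_r)) - V_r(Φ_{1,η^i})`. -/
noncomputable def F₀ {n m : ℕ} (c : Curve) (D : Problem n m) (z : Trajectory n m) (i : Fin n)
    (r : Fin (c.N + 2)) : ℝ :=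
  partialD (D.Φ₀ (c.vertex r)) i (z.x (c.vertex r)) - jump c r (Φ₁η c D z i)

end Along

/-- The differentiability of the data along the trajectory under which the linearized equation and
the functions `F`, `F₁`, `F₀` are meaningful. -/
structure IsRegular {n m : ℕ} (c : Curve) (D : Problem n m) (z : Trajectory n m) : Prop where
  contDiff_f : ∀ P ∈ c.G, ∀ v ∈ Icc D.uLo D.uHi, ContDiff ℝ 1
    (fun y : (Fin n → ℝ) × (Fin n → ℝ) × (Fin n → ℝ) => D.f P y.1 y.2.1 y.2.2 v)
  continuousOn_fx : ∀ i k, ContinuousOn (fun P => fx D z P i k) c.G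
  continuousOn_fp : ∀ i k, ContinuousOn (fun P => fp D z P i k) c.G
  continuousOn_fq : ∀ i k, ContinuousOn (fun P => fq D z P i k) c.G
  contDiff_Φ : ∀ P ∈ c.G, ∀ v ∈ Icc D.uLo D.uHi, ContDiff ℝ 1
    (fun y : (Fin n → ℝ) × (Fin n → ℝ) × (Fin n → ℝ) => D.Φ P y.1 y.2.1 y.2.2 v)
  contDiff_Φ₁ : ∀ P ∈ c.gamma, ContDiff ℝ 1
    (fun y : (Fin n → ℝ) × (Fin n → ℝ) => D.Φ₁ P y.1 y.2)
  contDiff_Φ₀ : ∀ r, ContDiff ℝ 1 (D.Φ₀ (c.vertex r))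
  /-- The total derivatives in `F` exist almost everywhere in `G`, and `F` is integrable. -/
  differentiable_Φp : ∀ i, ∀ᵐ P ∂(volume.restrict c.G),
    DifferentiableAt ℝ (fun s => Φp D z i (s, P.2)) P.1
  differentiable_Φq : ∀ i, ∀ᵐ P ∂(volume.restrict c.G),
    DifferentiableAt ℝ (fun t => Φq D z i (P.1, t)) P.2
  integrable_F : ∀ i, IntegrableOn (F D z i) c.G
  /-- `Φ_{1,η}` is continuous on the open arcs between vertices, with one-sided limits at the
  vertices; its tangential derivative exists almost everywhere, and `F₁` is integrable. -/
  continuousOn_Φ₁η : ∀ i, ∀ r : Fin (c.N + 1),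
    ContinuousOn (Φ₁η c D z i) (Ioo (c.vparam r.castSucc) (c.vparam r.succ))
  rightLimit_Φ₁η : ∀ i, ∀ r : Fin (c.N + 1),
    ∃ l, Tendsto (Φ₁η c D z i) (𝓝[>] (c.vparam r.castSucc)) (𝓝 l)
  leftLimit_Φ₁η : ∀ i, ∀ r : Fin (c.N + 1),
    ∃ l, Tendsto (Φ₁η c D z i) (𝓝[<] (c.vparam r.succ)) (𝓝 l)
  differentiable_Φ₁η : ∀ i, ∀ᵐ μ ∂(volume.restrict (Icc 0 c.len)),
    DifferentiableAt ℝ (Φ₁η c D z i) μ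
  integrable_F₁ : ∀ i, IntegrableOn (F₁ c D z i) (Icc 0 c.len)

/-- `R P Q i j = R^i_j(s,t,σ,τ)`, with `P = (s,t) ∈ G` and `Q = (σ,τ) ∈ W(P)`, is the matrix-valued
Riemann function of the linearized equation along the trajectory: it is continuous together with
`Rs = ∂R/∂s` and `Rt = ∂R/∂t`, and it solves the characteristic problem
`R_st = f_x R + f_p R_s + f_q R_t` for `s > σ`, `t > τ`,
`R_s = f_q R` on `t = τ`, `R_t = f_p R` on `s = σ`, `R = 1` at `(s,t) = (σ,τ)`.
Derivatives at the boundary of the domain are one-sided. -/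
def IsRiemannFunction {n m : ℕ} (c : Curve) (D : Problem n m) (z : Trajectory n m)
    (R : ℝ × ℝ → ℝ × ℝ → Matrix (Fin n) (Fin n) ℝ) : Prop :=
  ∃ Rs Rt : ℝ × ℝ → ℝ × ℝ → Matrix (Fin n) (Fin n) ℝ,
    ContinuousOn (fun y : (ℝ × ℝ) × (ℝ × ℝ) => R y.1 y.2) {y | y.1 ∈ c.G ∧ y.2 ∈ W y.1} ∧
    ContinuousOn (fun y : (ℝ × ℝ) × (ℝ × ℝ) => Rs y.1 y.2) {y | y.1 ∈ c.G ∧ y.2 ∈ W y.1} ∧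
    ContinuousOn (fun y : (ℝ × ℝ) × (ℝ × ℝ) => Rt y.1 y.2) {y | y.1 ∈ c.G ∧ y.2 ∈ W y.1} ∧
    (∀ s t σ τ : ℝ, (s, t) ∈ c.G → (σ, τ) ∈ W (s, t) → ∀ i j,
      HasDerivWithinAt (fun s' => R (s', t) (σ, τ) i j) (Rs (s, t) (σ, τ) i j)
        {s' | σ ≤ s' ∧ (s', t) ∈ c.G} s ∧
      HasDerivWithinAt (fun t' => R (s, t') (σ, τ) i j) (Rt (s, t) (σ, τ) i j)
        {t' | τ ≤ t' ∧ (s, t') ∈ c.G} t) ∧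
    (∀ s t σ τ : ℝ, (s, t) ∈ c.G → (σ, τ) ∈ W (s, t) → σ < s → τ < t → ∀ i j,
      HasDerivWithinAt (fun t' => Rs (s, t') (σ, τ) i j)
        (∑ k, (fx D z (s, t) i k * R (s, t) (σ, τ) k j + fp D z (s, t) i k * Rs (s, t) (σ, τ) k j
          + fq D z (s, t) i k * Rt (s, t) (σ, τ) k j))
        {t' | τ ≤ t' ∧ (s, t') ∈ c.G} t) ∧
    (∀ s σ τ : ℝ, (s, τ) ∈ c.G → (σ, τ) ∈ W (s, τ) → ∀ i j,
      Rs (s, τ) (σ, τ) i j = ∑ k, fq D z (s, τ) i k * R (s, τ) (σ, τ) k j) ∧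
    (∀ t σ τ : ℝ, (σ, t) ∈ c.G → (σ, τ) ∈ W (σ, t) → ∀ i j,
      Rt (σ, t) (σ, τ) i j = ∑ k, fp D z (σ, t) i k * R (σ, t) (σ, τ) k j) ∧
    (∀ Q ∈ c.G, R Q Q = 1)

open Classical in
/-- The co-state `ψ_j(s,t)`; the vertex sum runs over the interior vertices `P₁, …, P_N`. -/
noncomputable def costate {n m : ℕ} (c : Curve) (D : Problem n m) (z : Trajectory n m)
    (R : ℝ × ℝ → ℝ × ℝ → Matrix (Fin n) (Fin n) ℝ) (j : Fin n) (Q : ℝ × ℝ) : ℝ :=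
  (∫ P in c.E Q, ∑ i, F D z i P * R P Q i j)
    + c.lineIntegral (c.gammaFrom Q) (fun μ => ∑ i, F₁ c D z i μ * R (c.pt μ) Q i j)
    + ∑ r : Fin c.N, if Q ∈ W (c.vertex r.castSucc.succ) then
        ∑ i, F₀ c D z i r.castSucc.succ * R (c.vertex r.castSucc.succ) Q i j else 0

end Goursat

/-! The theorem is dominated convergence plus the order geometry of a monotone curve. Each of the
three terms of the co-state at `Q` runs over the points that dominate `Q` coordinatewise, so
everything depends on which points still dominate `Q` as `Q` tends to a vertex `P` inside one
quadrant.

In the double integral nothing of positive area survives: no point of `G` strictly dominates a point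
of the curve (`snd_le_of_mem_G_of_fst_lt`), so off two coordinate lines every point of `G` fails to
dominate all `Q` near `P`, and the integral tends to 0.

On the curve, monotonicity and injectivity (the latter from unit speed) show that the points
dominating `P` are exactly those of `L(P)` (`pt_mem_L_iff`). From the lower left quadrant all of
them dominate `Q`; from the upper left one only the vertical piece `Lt` survives, from the lower
right one only the horizontal piece `Ls`. The point `P` itself survives only in the first case.

The Riemann function is bounded because its domain is compact, which supplies the dominating
function in `tendsto_setIntegral_riemann`. Each term of the finite vertex sum is eventually present
or eventually absent. `tendsto_costate` combines the three limits. -/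

namespace Goursat

/-! ### Geometry of the monotone curve -/

namespace Curve

variable (c : Curve)

lemma vparam_mem (r : Fin (c.N + 2)) : c.vparam r ∈ Icc 0 c.len := by
  constructor
  · rw [← c.vparam_zero]; exact c.vparam_strictMono.monotone (Fin.zero_le r)
  · rw [← c.vparam_last]; exact c.vparam_strictMono.monotone (Fin.le_last r)

lemma len_pos : 0 < c.len := by
  rw [← c.vparam_zero, ← c.vparam_last]
  exact c.vparam_strictMono (Fin.last_pos)

lemma zero_mem : (0 : ℝ) ∈ Icc 0 c.len := ⟨le_rfl, c.len_pos.le⟩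

lemma len_mem : c.len ∈ Icc 0 c.len := ⟨c.len_pos.le, le_rfl⟩

lemma fst_le_of_le {μ ν : ℝ} (hμ : μ ∈ Icc 0 c.len) (hν : ν ∈ Icc 0 c.len) (h : μ ≤ ν) :
    (c.pt ν).1 ≤ (c.pt μ).1 := c.fst_antitone hμ hν h

lemma snd_le_of_le {μ ν : ℝ} (hμ : μ ∈ Icc 0 c.len) (hν : ν ∈ Icc 0 c.len) (h : μ ≤ ν) :
    (c.pt μ).2 ≤ (c.pt ν).2 := c.snd_monotone hμ hν h

lemma fst_nonneg {μ : ℝ} (hμ : μ ∈ Icc 0 c.len) : 0 ≤ (c.pt μ).1 := by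
  simpa [c.pt_len] using c.fst_le_of_le hμ c.len_mem hμ.2

lemma snd_nonneg {μ : ℝ} (hμ : μ ∈ Icc 0 c.len) : 0 ≤ (c.pt μ).2 := by
  simpa [c.pt_zero] using c.snd_le_of_le c.zero_mem hμ hμ.1

lemma fst_le {μ : ℝ} (hμ : μ ∈ Icc 0 c.len) : (c.pt μ).1 ≤ c.a := by
  simpa [c.pt_zero] using c.fst_le_of_le c.zero_mem hμ hμ.1

lemma snd_le {μ : ℝ} (hμ : μ ∈ Icc 0 c.len) : (c.pt μ).2 ≤ c.b := by
  simpa [c.pt_len] using c.snd_le_of_le hμ c.len_mem hμ.2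

lemma fst_pos {μ : ℝ} (hμ : μ ∈ Icc 0 c.len) (h : μ < c.len) : 0 < (c.pt μ).1 := by
  rcases hμ.1.eq_or_lt with rfl | h0
  · simpa [c.pt_zero] using c.a_pos
  · exact (c.pos μ ⟨h0, h⟩).1

lemma snd_pos {μ : ℝ} (hμ : μ ∈ Icc 0 c.len) (h : 0 < μ) : 0 < (c.pt μ).2 := by
  rcases hμ.2.eq_or_lt with rfl | h0
  · simpa [c.pt_len] using c.b_pos
  · exact (c.pos μ ⟨h, h0⟩).2

/-- A parameter lying in no open arc and at no vertex would, by induction along the vertices, exceed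
all of them, including `len`. -/
lemma exists_arc {ν : ℝ} (hν : ν ∈ Icc 0 c.len) (h : ∀ r, c.vparam r ≠ ν) :
    ∃ r : Fin (c.N + 1), ν ∈ Ioo (c.vparam r.castSucc) (c.vparam r.succ) := by
  by_contra! hcon
  have key : ∀ r : Fin (c.N + 2), c.vparam r < ν := by
    intro r
    induction r using Fin.induction with
    | zero => exact lt_of_le_of_ne (by rw [c.vparam_zero]; exact hν.1) (h 0)
    | succ r ih => exact lt_of_le_of_ne (not_lt.1 fun hlt => hcon r ⟨ih, hlt⟩) (h _)
  have := key (Fin.last _)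
  rw [c.vparam_last] at this
  exact absurd hν.2 (not_le.2 this)

/-- If the curve returned to a point, monotonicity of both coordinates would keep it constant in
between, contradicting unit speed. -/
lemma pt_ne_of_lt {μ ν : ℝ} (hμ : μ ∈ Icc 0 c.len) (hν : ν ∈ Icc 0 c.len) (hlt : μ < ν) :
    c.pt μ ≠ c.pt ν := by
  intro heq
  have hsub : Icc μ ν ⊆ Icc 0 c.len := Icc_subset_Icc hμ.1 hν.2
  have hconst : ∀ ξ ∈ Icc μ ν, c.pt ξ = c.pt μ := by
    intro ξ hξ
    have hξ' := hsub hξ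
    refine Prod.ext (le_antisymm (c.fst_le_of_le hμ hξ' hξ.1) ?_)
      (le_antisymm ?_ (c.snd_le_of_le hμ hξ' hξ.1))
    · rw [heq]; exact c.fst_le_of_le hξ' hν hξ.2
    · rw [heq]; exact c.snd_le_of_le hξ' hν hξ.2
  -- Unit speed is only available on the open arcs, so `ξ` must avoid the finitely many vertices.
  obtain ⟨ξ, hξ, hξv⟩ : ∃ ξ ∈ Ioo μ ν, ξ ∉ range c.vparam :=
    (Ioo_infinite hlt).exists_notMem_finite (finite_range _)
  obtain ⟨r, hr⟩ := c.exists_arc (hsub (Ioo_subset_Icc_self hξ)) fun r hr => hξv ⟨r, hr⟩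
  have hev : ∀ᶠ η in 𝓝 ξ, c.pt η = c.pt μ := by
    filter_upwards [Ioo_mem_nhds hξ.1 hξ.2] with η hη using hconst η (Ioo_subset_Icc_self hη)
  have h1 : deriv (fun η => (c.pt η).1) ξ = 0 := by
    have : (fun η => (c.pt η).1) =ᶠ[𝓝 ξ] fun _ => (c.pt μ).1 := hev.mono fun η h => by simp [h]
    rw [this.deriv_eq, deriv_const]
  have h2 : deriv (fun η => (c.pt η).2) ξ = 0 := by
    have : (fun η => (c.pt η).2) =ᶠ[𝓝 ξ] fun _ => (c.pt μ).2 := hev.mono fun η h => by simp [h]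
    rw [this.deriv_eq, deriv_const]
  have := c.unit_speed r ξ hr
  rw [h1, h2] at this
  norm_num at this

lemma injOn_pt : InjOn c.pt (Icc 0 c.len) := by
  intro μ hμ ν hν h
  rcases lt_trichotomy μ ν with hlt | heq | hgt
  · exact absurd h (c.pt_ne_of_lt hμ hν hlt)
  · exact heq
  · exact absurd h.symm (c.pt_ne_of_lt hν hμ hgt)

lemma continuousOn_fst : ContinuousOn (fun μ => (c.pt μ).1) (Icc 0 c.len) :=
  continuous_fst.comp_continuousOn c.continuousOn

lemma continuousOn_snd : ContinuousOn (fun μ => (c.pt μ).2) (Icc 0 c.len) :=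
  continuous_snd.comp_continuousOn c.continuousOn

/-- The intermediate value theorem reaches every abscissa of the segment, while monotonicity pins
the ordinate. Hence the segment condition in `Ls` is automatic. -/
lemma segment_subset_gamma_of_snd_eq {μ ν : ℝ} (hμ : μ ∈ Icc 0 c.len) (hν : ν ∈ Icc 0 c.len)
    (hle : μ ≤ ν) (h : (c.pt μ).2 = (c.pt ν).2) : segment ℝ (c.pt μ) (c.pt ν) ⊆ c.gamma := by
  have hsub : Icc μ ν ⊆ Icc 0 c.len := Icc_subset_Icc hμ.1 hν.2
  rintro _ ⟨α, β, hα, hβ, hαβ, rfl⟩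
  have hst := c.fst_le_of_le hμ hν hle
  obtain ⟨ξ, hξ, hξ1⟩ : α * (c.pt μ).1 + β * (c.pt ν).1 ∈ (fun ξ => (c.pt ξ).1) '' Icc μ ν := by
    refine intermediate_value_Icc' hle (c.continuousOn_fst.mono hsub) ⟨?_, ?_⟩
    · obtain rfl : β = 1 - α := by linarith
      nlinarith
    · obtain rfl : α = 1 - β := by linarith
      nlinarith
  refine ⟨ξ, hsub hξ, Prod.ext (by simpa using hξ1) ?_⟩
  have h1 := c.snd_le_of_le hμ (hsub hξ) hξ.1
  have h2 := c.snd_le_of_le (hsub hξ) hν hξ.2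
  have h3 : (c.pt ξ).2 = (c.pt ν).2 := by linarith
  simp only [Prod.snd_add, Prod.smul_snd, smul_eq_mul, h, h3, ← add_mul, hαβ, one_mul]

lemma segment_subset_gamma_of_fst_eq {μ ν : ℝ} (hμ : μ ∈ Icc 0 c.len) (hν : ν ∈ Icc 0 c.len)
    (hle : μ ≤ ν) (h : (c.pt μ).1 = (c.pt ν).1) : segment ℝ (c.pt μ) (c.pt ν) ⊆ c.gamma := by
  have hsub : Icc μ ν ⊆ Icc 0 c.len := Icc_subset_Icc hμ.1 hν.2
  rintro _ ⟨α, β, hα, hβ, hαβ, rfl⟩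
  have hst := c.snd_le_of_le hμ hν hle
  obtain ⟨ξ, hξ, hξ1⟩ : α * (c.pt μ).2 + β * (c.pt ν).2 ∈ (fun ξ => (c.pt ξ).2) '' Icc μ ν := by
    refine intermediate_value_Icc hle (c.continuousOn_snd.mono hsub) ⟨?_, ?_⟩
    · obtain rfl : α = 1 - β := by linarith
      nlinarith
    · obtain rfl : β = 1 - α := by linarith
      nlinarith
  refine ⟨ξ, hsub hξ, Prod.ext ?_ (by simpa using hξ1)⟩
  have h1 := c.fst_le_of_le hμ (hsub hξ) hξ.1
  have h2 := c.fst_le_of_le (hsub hξ) hν hξ.2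
  have h3 : (c.pt ξ).1 = (c.pt ν).1 := by linarith
  simp only [Prod.fst_add, Prod.smul_fst, smul_eq_mul, h, h3, ← add_mul, hαβ, one_mul]

/-- Injectivity turns the condition on points into one on parameters, and the segment condition
drops out. -/
lemma pt_mem_Ls_iff {μ κ : ℝ} (hμ : μ ∈ Icc 0 c.len) (hκ : κ ∈ Icc 0 c.len) :
    c.pt μ ∈ c.Ls κ ↔ μ < κ ∧ (c.pt μ).2 = (c.pt κ).2 := by
  constructor
  · rintro ⟨ν, hν, heq, h2, -⟩
    rw [c.injOn_pt hμ ⟨hν.1, hν.2.le.trans hκ.2⟩ heq]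
    exact ⟨hν.2, heq ▸ h2⟩
  · rintro ⟨hlt, h2⟩
    exact ⟨μ, ⟨hμ.1, hlt⟩, rfl, h2, c.segment_subset_gamma_of_snd_eq hμ hκ hlt.le h2⟩

lemma pt_mem_Lt_iff {μ κ : ℝ} (hμ : μ ∈ Icc 0 c.len) (hκ : κ ∈ Icc 0 c.len) :
    c.pt μ ∈ c.Lt κ ↔ κ < μ ∧ (c.pt μ).1 = (c.pt κ).1 := by
  constructor
  · rintro ⟨ν, hν, heq, h2, -⟩
    rw [c.injOn_pt hμ ⟨hκ.1.trans hν.1.le, hν.2⟩ heq]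
    exact ⟨hν.1, heq ▸ h2⟩
  · rintro ⟨hlt, h2⟩
    exact ⟨μ, ⟨hlt, hμ.2⟩, rfl, h2, c.segment_subset_gamma_of_fst_eq hκ hμ hlt.le h2.symm⟩

/-- `L(P)` consists of the points of `(γ)` that dominate `P`. -/
lemma pt_mem_L_iff {μ κ : ℝ} (hμ : μ ∈ Icc 0 c.len) (hκ : κ ∈ Icc 0 c.len) :
    c.pt μ ∈ c.L κ ↔ c.pt κ ∈ W (c.pt μ) := by
  have hW : c.pt κ ∈ W (c.pt μ) ↔ (c.pt κ).1 ≤ (c.pt μ).1 ∧ (c.pt κ).2 ≤ (c.pt μ).2 :=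
    ⟨fun h => ⟨h.2.1, h.2.2.2⟩, fun h => ⟨c.fst_nonneg hκ, h.1, c.snd_nonneg hκ, h.2⟩⟩
  rw [L, mem_union, mem_union, c.pt_mem_Ls_iff hμ hκ, c.pt_mem_Lt_iff hμ hκ, hW,
    mem_singleton_iff]
  constructor
  · rintro ((⟨hlt, h⟩ | ⟨hlt, h⟩) | h)
    · exact ⟨c.fst_le_of_le hμ hκ hlt.le, h.ge⟩
    · exact ⟨h.ge, c.snd_le_of_le hκ hμ hlt.le⟩
    · exact ⟨h ▸ le_rfl, h ▸ le_rfl⟩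
  · rintro ⟨h1, h2⟩
    rcases lt_trichotomy μ κ with hlt | rfl | hlt
    · exact Or.inl (Or.inl ⟨hlt, le_antisymm (c.snd_le_of_le hμ hκ hlt.le) h2⟩)
    · exact Or.inr rfl
    · exact Or.inl (Or.inr ⟨hlt, le_antisymm (c.fst_le_of_le hκ hμ hlt.le) h1⟩)

/-! ### Compactness of the region and of the domain of the Riemann function -/

lemma isClosed_W_graph : IsClosed {y : (ℝ × ℝ) × (ℝ × ℝ) | y.2 ∈ W y.1} := by
  have h1 : IsClosed {y : (ℝ × ℝ) × (ℝ × ℝ) | 0 ≤ y.2.1} := isClosed_le (by fun_prop) (by fun_prop)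
  have h2 : IsClosed {y : (ℝ × ℝ) × (ℝ × ℝ) | y.2.1 ≤ y.1.1} :=
    isClosed_le (by fun_prop) (by fun_prop)
  have h3 : IsClosed {y : (ℝ × ℝ) × (ℝ × ℝ) | 0 ≤ y.2.2} := isClosed_le (by fun_prop) (by fun_prop)
  have h4 : IsClosed {y : (ℝ × ℝ) × (ℝ × ℝ) | y.2.2 ≤ y.1.2} :=
    isClosed_le (by fun_prop) (by fun_prop)
  exact h1.inter (h2.inter (h3.inter h4))

lemma isCompact_gamma : IsCompact c.gamma := isCompact_Icc.image_of_continuousOn c.continuousOn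

lemma nonneg_of_mem_G {Q : ℝ × ℝ} (h : Q ∈ c.G) : 0 ≤ Q.1 ∧ 0 ≤ Q.2 := by
  obtain ⟨P, -, hQ⟩ := h
  exact ⟨hQ.1, hQ.2.2.1⟩

lemma mem_Icc_of_mem_G {Q : ℝ × ℝ} (h : Q ∈ c.G) : Q ∈ Icc ((0, 0) : ℝ × ℝ) (c.a, c.b) := by
  obtain ⟨_, ⟨μ, hμ, rfl⟩, h1, h2, h3, h4⟩ := h
  exact ⟨⟨h1, h3⟩, ⟨h2.trans (c.fst_le hμ), h4.trans (c.snd_le hμ)⟩⟩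

lemma isCompact_G : IsCompact c.G := by
  have : c.G = Prod.snd '' ((c.gamma ×ˢ Icc ((0, 0) : ℝ × ℝ) (c.a, c.b)) ∩
      {y : (ℝ × ℝ) × (ℝ × ℝ) | y.2 ∈ W y.1}) := by
    ext Q
    constructor
    · rintro ⟨P, hP, hQ⟩
      exact ⟨(P, Q), ⟨⟨hP, c.mem_Icc_of_mem_G ⟨P, hP, hQ⟩⟩, hQ⟩, rfl⟩
    · rintro ⟨⟨P, Q⟩, ⟨⟨hP, -⟩, hQ⟩, rfl⟩
      exact ⟨P, hP, hQ⟩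
  rw [this]
  exact ((c.isCompact_gamma.prod isCompact_Icc).inter_right isClosed_W_graph).image continuous_snd

/-- Source of the uniform bound on the Riemann function. -/
lemma isCompact_riemannDomain :
    IsCompact {y : (ℝ × ℝ) × (ℝ × ℝ) | y.1 ∈ c.G ∧ y.2 ∈ W y.1} := by
  have : {y : (ℝ × ℝ) × (ℝ × ℝ) | y.1 ∈ c.G ∧ y.2 ∈ W y.1} =
      (c.G ×ˢ Icc ((0, 0) : ℝ × ℝ) (c.a, c.b)) ∩ {y : (ℝ × ℝ) × (ℝ × ℝ) | y.2 ∈ W y.1} := by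
    ext ⟨P, Q⟩
    constructor
    · rintro ⟨hP, h1, h2, h3, h4⟩
      have h := c.mem_Icc_of_mem_G hP
      exact ⟨⟨hP, ⟨h1, h3⟩, ⟨h2.trans h.2.1, h4.trans h.2.2⟩⟩, h1, h2, h3, h4⟩
    · rintro ⟨⟨hP, -⟩, hQ⟩
      exact ⟨hP, hQ⟩
  rw [this]
  exact (c.isCompact_G.prod isCompact_Icc).inter_right isClosed_W_graph

lemma gamma_subset_G : c.gamma ⊆ c.G := by
  rintro _ ⟨μ, hμ, rfl⟩
  exact ⟨c.pt μ, ⟨μ, hμ, rfl⟩, c.fst_nonneg hμ, le_rfl, c.snd_nonneg hμ, le_rfl⟩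

/-- No point of `G` strictly dominates a point of `(γ)`. -/
lemma snd_le_of_mem_G_of_fst_lt {κ : ℝ} (hκ : κ ∈ Icc 0 c.len) {P : ℝ × ℝ} (hP : P ∈ c.G)
    (h1 : (c.pt κ).1 < P.1) : P.2 ≤ (c.pt κ).2 := by
  obtain ⟨_, ⟨μ, hμ, rfl⟩, -, h2, -, h4⟩ := hP
  rcases le_total μ κ with h | h
  · exact h4.trans (c.snd_le_of_le hμ hκ h)
  · exact absurd (h2.trans (c.fst_le_of_le hκ hμ h)) (not_le.2 h1)

end Curve

/-! ### Dominated convergence against the Riemann kernel -/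

section Limits

variable {n : ℕ} {R : ℝ × ℝ → ℝ × ℝ → Matrix (Fin n) (Fin n) ℝ}

/-- `R` is continuous only within its domain, so `Q` has to stay in `W P` along the filter; this is
the role of `hev`. -/
lemma tendsto_sum_riemann {K S : Set (ℝ × ℝ)} {P P₀ : ℝ × ℝ}
    (hR : ContinuousOn (fun y : (ℝ × ℝ) × (ℝ × ℝ) => R y.1 y.2) {y | y.1 ∈ K ∧ y.2 ∈ W y.1})
    (hP : P ∈ K) (hP₀ : P₀ ∈ W P) (hev : ∀ᶠ Q in 𝓝[S] P₀, Q ∈ W P) (v : Fin n → ℝ) (j : Fin n) :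
    Tendsto (fun Q => ∑ i, v i * R P Q i j) (𝓝[S] P₀) (𝓝 (∑ i, v i * R P P₀ i j)) := by
  have hmaps : Tendsto (fun Q => (P, Q)) (𝓝[S] P₀)
      (𝓝[{y : (ℝ × ℝ) × (ℝ × ℝ) | y.1 ∈ K ∧ y.2 ∈ W y.1}] (P, P₀)) := by
    refine tendsto_nhdsWithin_iff.2 ⟨?_, hev.mono fun Q hQ => ⟨hP, hQ⟩⟩
    exact ((Continuous.prodMk_right P).tendsto P₀).mono_left nhdsWithin_le_nhds
  have hlim := (hR (P, P₀) ⟨hP, hP₀⟩).tendsto.comp hmaps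
  refine tendsto_finsetSum _ fun i _ => Tendsto.const_mul _ ?_
  exact ((continuous_apply j).comp (continuous_apply i)).continuousAt.tendsto.comp hlim

/-- Passage to the limit in the integrals `∫_{Q ∈ W(φ x)} g_i(x) R^i_j(φ x, Q) dν(x)` as `Q` tends
to `P₀` within `S`, when the domains of integration converge to `B` almost everywhere. -/
lemma tendsto_setIntegral_riemann {X : Type*} [TopologicalSpace X] [MeasurableSpace X]
    [OpensMeasurableSpace X] [TopologicalSpace.PseudoMetrizableSpace X] {ν : Measure X}
    {K : Set (ℝ × ℝ)}
    (hK : IsCompact {y : (ℝ × ℝ) × (ℝ × ℝ) | y.1 ∈ K ∧ y.2 ∈ W y.1})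
    (hR : ContinuousOn (fun y : (ℝ × ℝ) × (ℝ × ℝ) => R y.1 y.2) {y | y.1 ∈ K ∧ y.2 ∈ W y.1})
    {X₀ B : Set X} (hX₀ : IsClosed X₀) (hB : MeasurableSet B) (hBX : B ⊆ X₀)
    {φ : X → ℝ × ℝ} (hφ : ContinuousOn φ X₀) (hφK : MapsTo φ X₀ K)
    {g : Fin n → X → ℝ} (hg : ∀ i, IntegrableOn (g i) X₀ ν) (j : Fin n)
    {S : Set (ℝ × ℝ)} {P₀ : ℝ × ℝ}
    (hin : ∀ x ∈ B, P₀ ∈ W (φ x) ∧ ∀ᶠ Q in 𝓝[S] P₀, Q ∈ W (φ x))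
    (hout : ∀ᵐ x ∂ν, x ∈ X₀ → x ∉ B → ∀ᶠ Q in 𝓝[S] P₀, Q ∉ W (φ x)) :
    Tendsto (fun Q => ∫ x in {x | x ∈ X₀ ∧ Q ∈ W (φ x)}, ∑ i, g i x * R (φ x) Q i j ∂ν)
      (𝓝[S] P₀) (𝓝 (∫ x in B, ∑ i, g i x * R (φ x) P₀ i j ∂ν)) := by
  have hRij : ∀ i, ContinuousOn (fun y : (ℝ × ℝ) × (ℝ × ℝ) => R y.1 y.2 i j)
      {y | y.1 ∈ K ∧ y.2 ∈ W y.1} := fun i =>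
    continuousOn_pi.1 (continuousOn_pi.1 hR i) j
  choose M hM using fun i => hK.exists_bound_of_continuousOn (hRij i)
  have hclosed : ∀ Q, IsClosed {x | x ∈ X₀ ∧ Q ∈ W (φ x)} := fun Q =>
    hφ.preimage_isClosed_of_isClosed hX₀
      (Curve.isClosed_W_graph.preimage (f := fun P : ℝ × ℝ => (P, Q)) (by fun_prop))
  -- Moving the varying domain into an indicator gives integrals over one fixed space.
  simp_rw [← fun Q => integral_indicator (μ := ν) (f := fun x => ∑ i, g i x * R (φ x) Q i j)
    (hclosed Q).measurableSet]
  rw [← integral_indicator hB]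
  refine tendsto_integral_filter_of_dominated_convergence
    -- The absolute value of `M i` is needed because the bound may be negative when the domain is
    -- empty.
    (X₀.indicator fun x => ∑ i, |g i x| * |M i|) ?_ ?_ ?_ ?_
  · refine Eventually.of_forall fun Q => ?_
    rw [aestronglyMeasurable_indicator_iff (hclosed Q).measurableSet]
    refine Finset.aestronglyMeasurable_fun_sum _ fun i _ => ?_
    refine ((hg i).1.mono_measure (Measure.restrict_mono (fun x hx => hx.1) le_rfl)).mul ?_
    refine ContinuousOn.aestronglyMeasurable ?_ (hclosed Q).measurableSet
    refine (hRij i).comp ((hφ.mono fun x hx => hx.1).prodMk continuousOn_const) ?_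
    exact fun x hx => ⟨hφK hx.1, hx.2⟩
  · refine Eventually.of_forall fun Q => Eventually.of_forall fun x => ?_
    by_cases hx : x ∈ {x | x ∈ X₀ ∧ Q ∈ W (φ x)}
    · rw [indicator_of_mem hx, indicator_of_mem hx.1]
      refine (norm_sum_le _ _).trans (Finset.sum_le_sum fun i _ => ?_)
      rw [norm_mul, Real.norm_eq_abs]
      exact mul_le_mul_of_nonneg_left ((hM i (φ x, Q) ⟨hφK hx.1, hx.2⟩).trans (le_abs_self _))
        (abs_nonneg _)
    · rw [indicator_of_notMem hx, norm_zero]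
      exact indicator_nonneg (fun x _ => Finset.sum_nonneg fun i _ =>
        mul_nonneg (abs_nonneg _) (abs_nonneg _)) x
  · rw [integrable_indicator_iff hX₀.measurableSet]
    exact integrable_finsetSum _ fun i _ => (hg i).abs.mul_const _
  · filter_upwards [hout] with x hx
    by_cases hxB : x ∈ B
    · obtain ⟨hP, hev⟩ := hin x hxB
      rw [indicator_of_mem hxB]
      have hlim := tendsto_sum_riemann hR (hφK (hBX hxB)) hP hev (fun i => g i x) j
      refine hlim.congr' ?_
      filter_upwards [hev] with Q hQ
      rw [indicator_of_mem (show x ∈ {x | x ∈ X₀ ∧ Q ∈ W (φ x)} from ⟨hBX hxB, hQ⟩)]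
    · rw [indicator_of_notMem hxB]
      refine tendsto_const_nhds.congr' ?_
      by_cases hx0 : x ∈ X₀
      · filter_upwards [hx hx0 hxB] with Q hQ
        rw [indicator_of_notMem fun h => hQ h.2]
      · exact Eventually.of_forall fun Q => (indicator_of_notMem (fun h => hx0 h.1) _).symm

end Limits

/-! ### Limit of the co-state along a region -/

section Costate

variable {n m : ℕ} {c : Curve} {D : Problem n m} {z : Trajectory n m}
  {R : ℝ × ℝ → ℝ × ℝ → Matrix (Fin n) (Fin n) ℝ}

/-- Points that do not dominate `P₀` are eventually not dominating points near `P₀`. -/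
lemma eventually_notMem_W {S : Set (ℝ × ℝ)} {P P₀ : ℝ × ℝ} (h : P.1 < P₀.1 ∨ P.2 < P₀.2) :
    ∀ᶠ Q in 𝓝[S] P₀, Q ∉ W P := by
  refine Filter.Eventually.filter_mono nhdsWithin_le_nhds ?_
  rcases h with h | h
  · filter_upwards [continuous_fst.continuousAt.eventually_const_lt h] with Q hQ hW
    exact absurd hW.2.1 (not_le.2 hQ)
  · filter_upwards [continuous_snd.continuousAt.eventually_const_lt h] with Q hQ hW
    exact absurd hW.2.2.2 (not_le.2 hQ)

open Classical in
/-- The limit of the co-state at a point of `(γ)` along a region `S`, when the parameter sets of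
the arcs `γ(Q)` converge to `B` as `Q` approaches the point within `S`. -/
lemma tendsto_costate (hreg : IsRegular c D z) (hR : IsRiemannFunction c D z R) {κ : ℝ}
    (hκ : κ ∈ Icc 0 c.len) (j : Fin n) {S : Set (ℝ × ℝ)} {B : Set ℝ} (hB : MeasurableSet B)
    (hBX : B ⊆ Icc 0 c.len)
    (hin : ∀ μ ∈ B, c.pt κ ∈ W (c.pt μ) ∧ ∀ᶠ Q in 𝓝[S] (c.pt κ), Q ∈ W (c.pt μ))
    (hout : ∀ μ ∈ Icc 0 c.len, μ ∉ B → ∀ᶠ Q in 𝓝[S] (c.pt κ), Q ∉ W (c.pt μ)) :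
    Tendsto (costate c D z R j) (𝓝[S] (c.pt κ))
      (𝓝 ((∫ μ in B, ∑ i, F₁ c D z i μ * R (c.pt μ) (c.pt κ) i j)
        + ∑ r : Fin c.N, if c.vparam r.castSucc.succ ∈ B then
          ∑ i, F₀ c D z i r.castSucc.succ * R (c.vertex r.castSucc.succ) (c.pt κ) i j else 0)) := by
  obtain ⟨Rs, Rt, hRc, -⟩ := hR
  have hptK : MapsTo c.pt (Icc 0 c.len) c.G := fun μ hμ => c.gamma_subset_G ⟨μ, hμ, rfl⟩
  have hE : Tendsto (fun Q => ∫ P in c.E Q, ∑ i, F D z i P * R P Q i j) (𝓝[S] (c.pt κ)) (𝓝 0) := by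
    -- The two coordinate lines through the point are null; off them, every point of `G` lies
    -- strictly to the left of it or strictly below it, so the limit domain is `∅`.
    have hfst : ∀ᵐ P : ℝ × ℝ, P.1 ≠ (c.pt κ).1 :=
      Measure.quasiMeasurePreserving_fst.ae (Measure.ae_ne volume _)
    have hsnd : ∀ᵐ P : ℝ × ℝ, P.2 ≠ (c.pt κ).2 :=
      Measure.quasiMeasurePreserving_snd.ae (Measure.ae_ne volume _)
    have := tendsto_setIntegral_riemann (ν := volume) (g := F D z) (φ := id) (B := ∅) (S := S)
      (P₀ := c.pt κ) c.isCompact_riemannDomain hRc c.isCompact_G.isClosed MeasurableSet.empty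
      (empty_subset _) continuousOn_id (mapsTo_id _) hreg.integrable_F j (by simp) (by
        filter_upwards [hfst, hsnd] with P h1 h2 hP _
        refine eventually_notMem_W ?_
        rcases h1.lt_or_gt with h | h
        · exact Or.inl h
        · exact Or.inr (lt_of_le_of_ne (c.snd_le_of_mem_G_of_fst_lt hκ hP h) h2))
    simpa [Curve.E] using this
  have hL := tendsto_setIntegral_riemann (ν := volume) (g := F₁ c D z) (S := S)
      (P₀ := c.pt κ) c.isCompact_riemannDomain hRc isClosed_Icc hB hBX c.continuousOn hptK
      hreg.integrable_F₁ j hin (Eventually.of_forall hout)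
  have hsum : Tendsto (fun Q => ∑ r : Fin c.N, if Q ∈ W (c.vertex r.castSucc.succ) then
        ∑ i, F₀ c D z i r.castSucc.succ * R (c.vertex r.castSucc.succ) Q i j else 0)
      (𝓝[S] (c.pt κ)) (𝓝 (∑ r : Fin c.N, if c.vparam r.castSucc.succ ∈ B then
        ∑ i, F₀ c D z i r.castSucc.succ * R (c.vertex r.castSucc.succ) (c.pt κ) i j else 0)) := by
    refine tendsto_finsetSum _ fun r _ => ?_
    have hr := c.vparam_mem r.castSucc.succ
    by_cases hrB : c.vparam r.castSucc.succ ∈ B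
    · obtain ⟨hP, hev⟩ := hin _ hrB
      rw [if_pos hrB]
      have hlim := tendsto_sum_riemann hRc (hptK hr) hP hev
        (fun i => F₀ c D z i r.castSucc.succ) j
      refine hlim.congr' ?_
      filter_upwards [hev] with Q hQ
      exact (if_pos hQ).symm
    · rw [if_neg hrB]
      refine tendsto_const_nhds.congr' ?_
      filter_upwards [hout _ hr hrB] with Q hQ
      exact (if_neg hQ).symm
  have := (hE.add hL).add hsum
  rw [zero_add] at this
  refine this.congr fun Q => ?_
  rw [costate, Curve.lineIntegral]
  have hset : {μ | μ ∈ Icc 0 c.len ∧ c.pt μ ∈ c.gammaFrom Q} =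
      {μ | μ ∈ Icc 0 c.len ∧ Q ∈ W (c.pt μ)} := by
    ext μ
    exact ⟨fun h => ⟨h.1, h.2.2⟩, fun h => ⟨h.1, ⟨μ, h.1, rfl⟩, h.2⟩⟩
  rw [hset]

open Classical in
/-- A sum over a set of interior vertices, indexed by the interior vertices. -/
lemma sum_interior_vertices {N : ℕ} (U : Finset (Fin (N + 2))) (h0 : 0 ∉ U)
    (hlast : Fin.last (N + 1) ∉ U) (h : Fin (N + 2) → ℝ) (p : Fin (N + 2) → Prop)
    (hp : ∀ r, p r ↔ r ∈ U) :
    ∑ r : Fin N, (if p r.castSucc.succ then h r.castSucc.succ else 0) = ∑ r ∈ U, h r := by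
  have h1 : ∑ r ∈ U, h r = ∑ r, if p r then h r else 0 := by
    simp [hp, Finset.sum_ite_mem]
  -- Peeling off the first term and then the last leaves exactly the indices `r.castSucc.succ` used
  -- in the co-state.
  rw [h1, Fin.sum_univ_succ, Fin.sum_univ_castSucc, if_neg (mt (hp _).1 h0),
    Fin.succ_last, if_neg (mt (hp _).1 hlast)]
  simp

/-- `tendsto_costate` with the limit written as in the definition of the co-state. -/
lemma tendsto_costate_of_mem_iff (hreg : IsRegular c D z) (hR : IsRiemannFunction c D z R)
    {κ : ℝ} (hκ : κ ∈ Icc 0 c.len) (j : Fin n) {S A : Set (ℝ × ℝ)} {U : Finset (Fin (c.N + 2))}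
    (hU : ∀ r, c.vertex r ∈ A ↔ r ∈ U) (h0 : 0 ∉ U) (hlast : Fin.last (c.N + 1) ∉ U)
    (hB : MeasurableSet {μ | μ ∈ Icc 0 c.len ∧ c.pt μ ∈ A})
    (hin : ∀ μ ∈ Icc 0 c.len, c.pt μ ∈ A →
      c.pt κ ∈ W (c.pt μ) ∧ ∀ᶠ Q in 𝓝[S] (c.pt κ), Q ∈ W (c.pt μ))
    (hout : ∀ μ ∈ Icc 0 c.len, c.pt μ ∉ A → ∀ᶠ Q in 𝓝[S] (c.pt κ), Q ∉ W (c.pt μ)) :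
    Tendsto (costate c D z R j) (𝓝[S] (c.pt κ))
      (𝓝 (c.lineIntegral A (fun μ => ∑ i, F₁ c D z i μ * R (c.pt μ) (c.pt κ) i j)
        + ∑ r ∈ U, ∑ i, F₀ c D z i r * R (c.vertex r) (c.pt κ) i j)) := by
  classical
  have := tendsto_costate hreg hR hκ j (S := S) hB (fun μ h => h.1) (fun μ h => hin μ h.1 h.2)
    fun μ hμ h => hout μ hμ fun hA => h ⟨hμ, hA⟩
  rwa [sum_interior_vertices U h0 hlast
    (fun r => ∑ i, F₀ c D z i r * R (c.vertex r) (c.pt κ) i j)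
    (fun r => c.vparam r ∈ {μ | μ ∈ Icc 0 c.len ∧ c.pt μ ∈ A})
    fun r => ⟨fun h => (hU r).1 h.2, fun h => ⟨c.vparam_mem r, (hU r).2 h⟩⟩] at this

end Costate

/-! ### Vertex index sets and measurability of the limit arcs -/

namespace Curve

variable (c : Curve)

lemma vertex_zero : c.vertex 0 = (c.a, 0) := by rw [vertex, c.vparam_zero, c.pt_zero]

lemma vertex_last : c.vertex (Fin.last (c.N + 1)) = (0, c.b) := by
  rw [vertex, c.vparam_last, c.pt_len]

lemma nonneg_of_mem_interior {Q : ℝ × ℝ} (h : Q ∈ interior c.G) : 0 ≤ Q.1 ∧ 0 ≤ Q.2 :=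
  c.nonneg_of_mem_G (interior_subset h)

lemma mem_S_iff {k r : Fin (c.N + 2)} :
    r ∈ c.S k ↔ c.vparam r < c.vparam k ∧ (c.vertex r).2 = (c.vertex k).2 := by
  simp only [S, Finset.mem_filter, Finset.mem_univ, true_and]
  exact c.pt_mem_Ls_iff (c.vparam_mem r) (c.vparam_mem k)

/-- The curve leaves the `s`-axis at once, so no later vertex has the height of the initial one. The
co-state sums over interior vertices only, so the end points must be kept out of `S` and `T`. -/
lemma zero_notMem_S (k : Fin (c.N + 2)) : 0 ∉ c.S k := by
  intro h
  rw [c.mem_S_iff] at h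
  have hpos := c.snd_pos (c.vparam_mem k) (by simpa [c.vparam_zero] using h.1)
  have h2 := h.2
  rw [vertex_zero] at h2
  exact hpos.ne h2

lemma last_notMem_S (k : Fin (c.N + 2)) : Fin.last (c.N + 1) ∉ c.S k := by
  intro h
  rw [c.mem_S_iff] at h
  rw [c.vparam_last] at h
  exact absurd (c.vparam_mem k).2 (not_le.2 h.1)

lemma mem_T_iff {k r : Fin (c.N + 2)} :
    r ∈ c.T k ↔ c.vparam k < c.vparam r ∧ (c.vertex r).1 = (c.vertex k).1 := by
  simp only [T, Finset.mem_filter, Finset.mem_univ, true_and]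
  exact c.pt_mem_Lt_iff (c.vparam_mem r) (c.vparam_mem k)

lemma zero_notMem_T (k : Fin (c.N + 2)) : 0 ∉ c.T k := by
  intro h
  rw [c.mem_T_iff] at h
  rw [c.vparam_zero] at h
  exact absurd (c.vparam_mem k).1 (not_le.2 h.1)

lemma last_notMem_T (k : Fin (c.N + 2)) : Fin.last (c.N + 1) ∉ c.T k := by
  intro h
  rw [c.mem_T_iff] at h
  have hpos := c.fst_pos (c.vparam_mem k) (by simpa [c.vparam_last] using h.1)
  have h2 := h.2
  rw [vertex_last] at h2
  exact hpos.ne h2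

lemma vertex_mem_L_iff (k r : Fin (c.N + 2)) : c.vertex r ∈ c.L (c.vparam k) ↔ r ∈ c.V k := by
  have hinj : c.vertex r = c.pt (c.vparam k) ↔ r = k :=
    ⟨fun h => c.vparam_strictMono.injective (c.injOn_pt (c.vparam_mem r) (c.vparam_mem k) h),
      fun h => h ▸ rfl⟩
  simp only [L, V, S, T, mem_union, Finset.mem_union, Finset.mem_filter, Finset.mem_univ,
    true_and, mem_singleton_iff, Finset.mem_singleton, hinj]
  tauto

/-- The end points lie on the axes, and points of `G` have nonnegative coordinates. -/
lemma WIII_eq_empty {k : Fin (c.N + 2)} (h : k = 0 ∨ k = Fin.last (c.N + 1)) :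
    c.WIII (c.vertex k) = ∅ := by
  refine eq_empty_of_forall_notMem fun Q hQ => ?_
  obtain ⟨hG, h1, h2⟩ := hQ
  have := c.nonneg_of_mem_interior hG
  rcases h with rfl | rfl
  · rw [vertex_zero] at h2; exact absurd this.2 (not_le.2 h2)
  · rw [vertex_last] at h1; exact absurd this.1 (not_le.2 h1)

lemma measurableSet_param_L {κ : ℝ} (hκ : κ ∈ Icc 0 c.len) :
    MeasurableSet {μ | μ ∈ Icc 0 c.len ∧ c.pt μ ∈ c.L κ} := by
  have : {μ | μ ∈ Icc 0 c.len ∧ c.pt μ ∈ c.L κ} =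
      Icc 0 c.len ∩ c.pt ⁻¹' {P | c.pt κ ∈ W P} := by
    ext μ
    exact and_congr_right fun hμ => c.pt_mem_L_iff hμ hκ
  rw [this]
  exact (c.continuousOn.preimage_isClosed_of_isClosed isClosed_Icc
    (isClosed_W_graph.preimage (f := fun P : ℝ × ℝ => (P, c.pt κ)) (by fun_prop))).measurableSet

lemma measurableSet_param_Ls {κ : ℝ} (hκ : κ ∈ Icc 0 c.len) :
    MeasurableSet {μ | μ ∈ Icc 0 c.len ∧ c.pt μ ∈ c.Ls κ} := by
  have : {μ | μ ∈ Icc 0 c.len ∧ c.pt μ ∈ c.Ls κ} =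
      (Icc 0 c.len ∩ (fun μ => (c.pt μ).2) ⁻¹' {(c.pt κ).2}) ∩ Iio κ := by
    ext μ
    constructor
    · rintro ⟨hμ, h⟩
      have h := (c.pt_mem_Ls_iff hμ hκ).1 h
      exact ⟨⟨hμ, h.2⟩, h.1⟩
    · rintro ⟨⟨hμ, h⟩, hlt⟩
      exact ⟨hμ, (c.pt_mem_Ls_iff hμ hκ).2 ⟨hlt, h⟩⟩
  rw [this]
  exact (c.continuousOn_snd.preimage_isClosed_of_isClosed isClosed_Icc
    isClosed_singleton).measurableSet.inter measurableSet_Iio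

lemma measurableSet_param_Lt {κ : ℝ} (hκ : κ ∈ Icc 0 c.len) :
    MeasurableSet {μ | μ ∈ Icc 0 c.len ∧ c.pt μ ∈ c.Lt κ} := by
  have : {μ | μ ∈ Icc 0 c.len ∧ c.pt μ ∈ c.Lt κ} =
      (Icc 0 c.len ∩ (fun μ => (c.pt μ).1) ⁻¹' {(c.pt κ).1}) ∩ Ioi κ := by
    ext μ
    constructor
    · rintro ⟨hμ, h⟩
      have h := (c.pt_mem_Lt_iff hμ hκ).1 h
      exact ⟨⟨hμ, h.2⟩, h.1⟩
    · rintro ⟨⟨hμ, h⟩, hlt⟩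
      exact ⟨hμ, (c.pt_mem_Lt_iff hμ hκ).2 ⟨hlt, h⟩⟩
  rw [this]
  exact (c.continuousOn_fst.preimage_isClosed_of_isClosed isClosed_Icc
    isClosed_singleton).measurableSet.inter measurableSet_Ioi

lemma pt_mem_W_of_le {κ : ℝ} (hκ : κ ∈ Icc 0 c.len) {P : ℝ × ℝ} (h1 : (c.pt κ).1 ≤ P.1)
    (h2 : (c.pt κ).2 ≤ P.2) : c.pt κ ∈ W P := ⟨c.fst_nonneg hκ, h1, c.snd_nonneg hκ, h2⟩

end Curve

/-! ### Which points of the curve survive in each quadrant -/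

section Regions

variable {c : Curve} {κ μ : ℝ}

lemma eventually_mem_W_WIII (hκ : κ ∈ Icc 0 c.len) (hμ : μ ∈ Icc 0 c.len)
    (h : c.pt μ ∈ c.L κ) :
    c.pt κ ∈ W (c.pt μ) ∧ ∀ᶠ Q in 𝓝[c.WIII (c.pt κ)] (c.pt κ), Q ∈ W (c.pt μ) := by
  have hW := (c.pt_mem_L_iff hμ hκ).1 h
  refine ⟨hW, ?_⟩
  filter_upwards [self_mem_nhdsWithin] with Q ⟨hG, h1, h2⟩
  have h0 := c.nonneg_of_mem_interior hG
  exact ⟨h0.1, h1.le.trans hW.2.1, h0.2, h2.le.trans hW.2.2.2⟩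

lemma eventually_notMem_W_WIII (hκ : κ ∈ Icc 0 c.len) (hμ : μ ∈ Icc 0 c.len)
    (h : c.pt μ ∉ c.L κ) : ∀ᶠ Q in 𝓝[c.WIII (c.pt κ)] (c.pt κ), Q ∉ W (c.pt μ) := by
  refine eventually_notMem_W ?_
  by_contra! hle
  exact h ((c.pt_mem_L_iff hμ hκ).2 (c.pt_mem_W_of_le hκ hle.1 hle.2))

lemma eventually_mem_W_WII (hκ : κ ∈ Icc 0 c.len) (hμ : μ ∈ Icc 0 c.len)
    (h : c.pt μ ∈ c.Lt κ) :
    c.pt κ ∈ W (c.pt μ) ∧ ∀ᶠ Q in 𝓝[c.WII (c.pt κ)] (c.pt κ), Q ∈ W (c.pt μ) := by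
  obtain ⟨hlt, heq⟩ := (c.pt_mem_Lt_iff hμ hκ).1 h
  have hle := c.snd_le_of_le hκ hμ hlt.le
  refine ⟨c.pt_mem_W_of_le hκ heq.ge hle, ?_⟩
  -- Equal abscissas force distinct ordinates by injectivity; this strict gap leaves room for `Q`
  -- slightly above the vertex.
  have hlt2 : (c.pt κ).2 < (c.pt μ).2 :=
    lt_of_le_of_ne hle fun h2 => c.pt_ne_of_lt hκ hμ hlt (Prod.ext heq.symm h2)
  filter_upwards [self_mem_nhdsWithin, nhdsWithin_le_nhds
    (continuous_snd.continuousAt.eventually_lt_const hlt2)] with Q hQS hQ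
  obtain ⟨hG, h1, -⟩ := hQS
  have h0 := c.nonneg_of_mem_interior hG
  exact ⟨h0.1, heq ▸ h1.le, h0.2, le_of_lt hQ⟩

/-- Points up to and including the vertex are never higher than it, hence always below `Q`; this is
why the vertex itself does not contribute. Later points off its vertical line lie strictly to the
left. -/
lemma eventually_notMem_W_WII (hκ : κ ∈ Icc 0 c.len) (hμ : μ ∈ Icc 0 c.len)
    (h : c.pt μ ∉ c.Lt κ) : ∀ᶠ Q in 𝓝[c.WII (c.pt κ)] (c.pt κ), Q ∉ W (c.pt μ) := by
  rcases le_or_gt μ κ with hle | hlt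
  · filter_upwards [self_mem_nhdsWithin] with Q ⟨_, _, h2⟩ hW
    exact absurd (hW.2.2.2.trans (c.snd_le_of_le hμ hκ hle)) (not_le.2 h2)
  · exact eventually_notMem_W (Or.inl (lt_of_le_of_ne (c.fst_le_of_le hκ hμ hlt.le)
      fun heq => h ((c.pt_mem_Lt_iff hμ hκ).2 ⟨hlt, heq⟩)))

lemma eventually_mem_W_WIV (hκ : κ ∈ Icc 0 c.len) (hμ : μ ∈ Icc 0 c.len)
    (h : c.pt μ ∈ c.Ls κ) :
    c.pt κ ∈ W (c.pt μ) ∧ ∀ᶠ Q in 𝓝[c.WIV (c.pt κ)] (c.pt κ), Q ∈ W (c.pt μ) := by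
  obtain ⟨hlt, heq⟩ := (c.pt_mem_Ls_iff hμ hκ).1 h
  have hle := c.fst_le_of_le hμ hκ hlt.le
  refine ⟨c.pt_mem_W_of_le hκ hle heq.ge, ?_⟩
  have hlt2 : (c.pt κ).1 < (c.pt μ).1 :=
    lt_of_le_of_ne hle fun h2 => c.pt_ne_of_lt hμ hκ hlt (Prod.ext h2.symm heq)
  filter_upwards [self_mem_nhdsWithin, nhdsWithin_le_nhds
    (continuous_fst.continuousAt.eventually_lt_const hlt2)] with Q hQS hQ
  obtain ⟨hG, -, h2⟩ := hQS
  have h0 := c.nonneg_of_mem_interior hG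
  exact ⟨h0.1, le_of_lt hQ, h0.2, heq ▸ h2.le⟩

lemma eventually_notMem_W_WIV (hκ : κ ∈ Icc 0 c.len) (hμ : μ ∈ Icc 0 c.len)
    (h : c.pt μ ∉ c.Ls κ) : ∀ᶠ Q in 𝓝[c.WIV (c.pt κ)] (c.pt κ), Q ∉ W (c.pt μ) := by
  rcases le_or_gt κ μ with hle | hlt
  · filter_upwards [self_mem_nhdsWithin] with Q ⟨_, h1, _⟩ hW
    exact absurd (hW.2.1.trans (c.fst_le_of_le hκ hμ hle)) (not_le.2 h1)
  · exact eventually_notMem_W (Or.inr (lt_of_le_of_ne (c.snd_le_of_le hμ hκ hlt.le)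
      fun heq => h ((c.pt_mem_Ls_iff hμ hκ).2 ⟨hlt, heq⟩)))

end Regions

end Goursat

theorem theorem4p2 {n m : ℕ} (c : Goursat.Curve) (D : Goursat.Problem n m)
    (z : Goursat.Trajectory n m) (R : ℝ × ℝ → ℝ × ℝ → Matrix (Fin n) (Fin n) ℝ)
    (hz : Goursat.IsAdmissible c D z) (hreg : Goursat.IsRegular c D z)
    (hR : Goursat.IsRiemannFunction c D z R) (k : Fin (c.N + 2)) (j : Fin n) :
    Tendsto (Goursat.costate c D z R j) (𝓝[c.WIII (c.vertex k)] (c.vertex k))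
      (𝓝 (c.lineIntegral (c.L (c.vparam k))
            (fun μ => ∑ i, Goursat.F₁ c D z i μ * R (c.pt μ) (c.vertex k) i j)
          + ∑ r ∈ c.V k, ∑ i, Goursat.F₀ c D z i r * R (c.vertex r) (c.vertex k) i j)) ∧
    Tendsto (Goursat.costate c D z R j) (𝓝[c.WII (c.vertex k)] (c.vertex k))
      (𝓝 (c.lineIntegral (c.Lt (c.vparam k))
            (fun μ => ∑ i, Goursat.F₁ c D z i μ * R (c.pt μ) (c.vertex k) i j)
          + ∑ r ∈ c.T k, ∑ i, Goursat.F₀ c D z i r * R (c.vertex r) (c.vertex k) i j)) ∧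
    Tendsto (Goursat.costate c D z R j) (𝓝[c.WIV (c.vertex k)] (c.vertex k))
      (𝓝 (c.lineIntegral (c.Ls (c.vparam k))
            (fun μ => ∑ i, Goursat.F₁ c D z i μ * R (c.pt μ) (c.vertex k) i j)
          + ∑ r ∈ c.S k, ∑ i, Goursat.F₀ c D z i r * R (c.vertex r) (c.vertex k) i j)) := by
  have hκ := c.vparam_mem k
  refine ⟨?_, ?_, ?_⟩
  -- `V k` always contains `k`, whereas the co-state sum omits the two end vertices. There the
  -- region is empty and the limit is vacuous.
  · by_cases hk : k = 0 ∨ k = Fin.last (c.N + 1)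
    · rw [c.WIII_eq_empty hk, nhdsWithin_empty]
      exact tendsto_bot
    · push Not at hk
      refine Goursat.tendsto_costate_of_mem_iff hreg hR hκ j (c.vertex_mem_L_iff k) ?_ ?_
        (c.measurableSet_param_L hκ) (fun μ => Goursat.eventually_mem_W_WIII hκ)
        (fun μ => Goursat.eventually_notMem_W_WIII hκ)
      · simpa [Goursat.Curve.V, c.zero_notMem_S, c.zero_notMem_T] using hk.1.symm
      · simpa [Goursat.Curve.V, c.last_notMem_S, c.last_notMem_T] using hk.2.symm
  · exact Goursat.tendsto_costate_of_mem_iff hreg hR hκ j (by simp [Goursat.Curve.T])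
      (c.zero_notMem_T k) (c.last_notMem_T k) (c.measurableSet_param_Lt hκ)
      (fun μ => Goursat.eventually_mem_W_WII hκ) (fun μ => Goursat.eventually_notMem_W_WII hκ)
  · exact Goursat.tendsto_costate_of_mem_iff hreg hR hκ j (by simp [Goursat.Curve.S])
      (c.zero_notMem_S k) (c.last_notMem_S k) (c.measurableSet_param_Ls hκ)
      (fun μ => Goursat.eventually_mem_W_WIV hκ) (fun μ => Goursat.eventually_notMem_W_WIV hκ)
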